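/- All graphs are finite. An oriented graph is a digraph without loops and with at most one arc between any two vertices; $N^+(v)$ and $N^-(v)$ denote the sets of out-neighbours and of in-neighbours of $v$. It is a local tournament if for every vertex $v$ each of $N^+(v)$ and $N^-(v)$ induces a tournament, and it is locally transitive if each of these sets induces a transitive tournament. A simple graph is local-tournament-orientable if its edges can be oriented so that the result is a local tournament. A partial orientation of a simple graph $G=(V,E_G)$ is a partially oriented graph $P=(V,A\cup E)$ obtained from $G$ by replacing some (possibly none or all) of its edges by arcs, in one direction each; $A$ is the set of arcs and $E$ is the set of remaining edges. To complete $P$ means to replace each edge in $E$ by an arc in one of the two directions, keeping all arcs in $A$. Directed cycles and in- and out-neighbourhoods in $P$ are those of the oriented graph $(V,A)$. Let $G^+$ be the graph whose vertices are the ordered pairs $(u,v)$ with $uv\in E_G$, where distinct $(u,v)$ and $(u',v')$ are adjacent iff $u=u'$ and $vv'\notin E_G$, or $v=v'$ and $uu'\notin E_G$, or $(u',v')=(v,u)$. An edge $uv$ of $G$ corresponds to the vertices $(u,v)$ and $(v,u)$ of $G^+$, which lie in the same connected component. The partial orientation $P$ is friendly if 1. for all vertices $p,q$ of $G^+$ in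 the same connected component of $G^+$: if the distance of $p$ and $q$ is odd, then $A$ does not contain both $p$ and $q$, and if it is even, then $A$ does not contain exactly one of $p$ and $q$; and 2. there is no triangle of $G$ whose three edges correspond to vertices from three different connected components of $G^+$ and exactly two of whose edges are oriented in $P$. Two vertices are similar if they have the same closed neighbourhood in $G$; a cell is a maximal set of pairwise similar vertices. A vertex is universal if it is adjacent to all other vertices of $G$, and a cell is non-universal if it is not the cell formed by the universal vertices. **Theorem.** Let $G$ be a connected, local-tournament-orientable graph and let $P$ be a friendly partial orientation of $G$. Then $P$ can be completed to a locally transitive local tournament if and only if $P$ has no directed cycle whose vertices all lie in - a non-universal cell, or - the in-neighbourhood $N^-(v)$ or the out-neighbourhood $N^+(v)$ of a vertex $v$ of $P$. -/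

import Mathlib

universe u

/-- An oriented graph: a digraph without loops and without two arcs joining the same pair of
vertices. (Asymmetry excludes loops as well.) -/
structure OrientedGraph (V : Type u) where
  /-- `Arc x y`: there is an arc from `x` to `y`, that is, `x` dominates `y`. -/
  Arc : V → V → Prop
  asymm : ∀ x y, Arc x y → ¬ Arc y x

namespace OrientedGraph

variable {V : Type u}

/-- The underlying simple graph, obtained by forgetting the directions of the arcs. -/
def underlyingGraph (D : OrientedGraph V) : SimpleGraph V where
  Adj x y := D.Arc x y ∨ D.Arc y x
  symm := ⟨fun _ _ h => h.symm⟩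
  loopless := ⟨fun x h => h.elim (fun h' => D.asymm x x h' h') (fun h' => D.asymm x x h' h')⟩

/-- The out-neighbourhood of `v`. -/
def outNbhd (D : OrientedGraph V) (v : V) : Set V := {w | D.Arc v w}

/-- The in-neighbourhood of `v`. -/
def inNbhd (D : OrientedGraph V) (v : V) : Set V := {w | D.Arc w v}

/-- The vertex set `S` induces a tournament in `D`. -/
def InducesTournament (D : OrientedGraph V) (S : Set V) : Prop :=
  ∀ x ∈ S, ∀ y ∈ S, x ≠ y → D.Arc x y ∨ D.Arc y x

/-- The vertex set `S` induces a transitive tournament in `D`. -/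
def InducesTransitiveTournament (D : OrientedGraph V) (S : Set V) : Prop :=
  D.InducesTournament S ∧
    ∀ x ∈ S, ∀ y ∈ S, ∀ z ∈ S, D.Arc x y → D.Arc y z → D.Arc x z

/-- Local tournament: the in- and the out-neighbourhood of each vertex induce tournaments. -/
def IsLocalTournament (D : OrientedGraph V) : Prop :=
  ∀ v, D.InducesTournament (D.inNbhd v) ∧ D.InducesTournament (D.outNbhd v)

/-- Locally transitive: the in- and the out-neighbourhood of each vertex induce transitive
tournaments. -/
def IsLocallyTransitive (D : OrientedGraph V) : Prop :=
  ∀ v, D.InducesTransitiveTournament (D.inNbhd v) ∧ D.InducesTransitiveTournament (D.outNbhd v)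

/-- `D` has a directed cycle `c 0 → c 1 → ⋯ → c n → c 0` (addition in `Fin (n + 1)` is cyclic) all
of whose vertices lie in `S`. Asymmetry forces its length `n + 1` to be at least `3`. -/
def HasDirectedCycleIn (D : OrientedGraph V) (S : Set V) : Prop :=
  ∃ (n : ℕ) (c : Fin (n + 1) → V), Function.Injective c ∧ (∀ i, c i ∈ S) ∧
    ∀ i, D.Arc (c i) (c (i + 1))

end OrientedGraph

namespace SimpleGraph

variable {V : Type u}

/-- `G` is local tournament orientable: some orientation of `G` is a local tournament. -/
def LocalTournamentOrientable (G : SimpleGraph V) : Prop :=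
  ∃ D : OrientedGraph V, D.underlyingGraph = G ∧ D.IsLocalTournament

/-- The auxiliary graph `G⁺`. Its vertices are the ordered pairs `(u, v)` with `uv` an edge of `G`;
distinct vertices `(u, v)` and `(u', v')` are adjacent iff `u = u'` and `vv'` is not an edge, or
`v = v'` and `uu'` is not an edge, or `(u', v') = (v, u)`. -/
def auxGraph (G : SimpleGraph V) : SimpleGraph {p : V × V // G.Adj p.1 p.2} where
  Adj p q := p ≠ q ∧
    ((p.1.1 = q.1.1 ∧ ¬ G.Adj p.1.2 q.1.2) ∨
      (¬ G.Adj p.1.1 q.1.1 ∧ p.1.2 = q.1.2) ∨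
      (p.1.1 = q.1.2 ∧ p.1.2 = q.1.1))
  symm := ⟨by
    rintro p q ⟨hne, h⟩
    refine ⟨hne.symm, ?_⟩
    rcases h with ⟨h1, h2⟩ | ⟨h1, h2⟩ | ⟨h1, h2⟩
    · exact Or.inl ⟨h1.symm, fun h => h2 h.symm⟩
    · exact Or.inr (Or.inl ⟨fun h => h1 h.symm, h2.symm⟩)
    · exact Or.inr (Or.inr ⟨h2.symm, h1.symm⟩)⟩
  loopless := ⟨fun _ h => h.1 rfl⟩

/-- The connected component of `G⁺` to which the edge `xy` of `G` corresponds. (The two vertices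
`(x, y)` and `(y, x)` of `G⁺` are adjacent, so the choice between them is immaterial.) -/
def edgeComponent (G : SimpleGraph V) {x y : V} (h : G.Adj x y) : G.auxGraph.ConnectedComponent :=
  G.auxGraph.connectedComponentMk ⟨(x, y), h⟩

/-- Two vertices are similar if they have the same closed neighbourhood. -/
def Similar (G : SimpleGraph V) (x y : V) : Prop :=
  insert x (G.neighborSet x) = insert y (G.neighborSet y)

/-- A cell: (the vertex set of) a maximal subgraph of pairwise similar vertices. -/
def IsCell (G : SimpleGraph V) (B : Set V) : Prop :=
  Maximal (fun S : Set V => ∀ x ∈ S, ∀ y ∈ S, G.Similar x y) B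

/-- The set of universal vertices, those adjacent to all other vertices. -/
def universalVertices (G : SimpleGraph V) : Set V := {v | ∀ w, w ≠ v → G.Adj v w}

/-- A non-universal cell: a cell other than the one formed by the universal vertices. -/
def IsNonUniversalCell (G : SimpleGraph V) (B : Set V) : Prop :=
  G.IsCell B ∧ B ≠ G.universalVertices

end SimpleGraph

/-- A partially oriented graph: the edge-disjoint union of a simple graph and an oriented graph on
the same vertex set. -/
structure PartiallyOrientedGraph (V : Type u) where
  /-- The graph of the (non-oriented) edges. -/
  edges : SimpleGraph V
  /-- The oriented graph of the arcs. -/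
  arcs : OrientedGraph V
  disjoint : ∀ x y, edges.Adj x y → ¬ arcs.underlyingGraph.Adj x y

namespace PartiallyOrientedGraph

variable {V : Type u}

/-- The underlying graph of a partially oriented graph. -/
def underlyingGraph (P : PartiallyOrientedGraph V) : SimpleGraph V :=
  P.edges ⊔ P.arcs.underlyingGraph

/-- `P` is a partial orientation of the graph `G`. -/
def IsPartialOrientationOf (P : PartiallyOrientedGraph V) (G : SimpleGraph V) : Prop :=
  P.underlyingGraph = G

/-- `P` can be completed to `D`: the oriented graph `D` arises from `P` by keeping all arcs and
replacing each edge by an arc in one of the two directions. -/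
def CompletesTo (P : PartiallyOrientedGraph V) (D : OrientedGraph V) : Prop :=
  D.underlyingGraph = P.underlyingGraph ∧ ∀ x y, P.arcs.Arc x y → D.Arc x y

/-- `P` is consentaneous: for vertices `p`, `q` of `G⁺` (`G` the underlying graph of `P`) in one
connected component of `G⁺`, `P` does not contain both as arcs if they are at odd distance, and does
not contain exactly one of them as an arc if they are at even distance. -/
def Consentaneous (P : PartiallyOrientedGraph V) : Prop :=
  ∀ p q : {p : V × V // P.underlyingGraph.Adj p.1 p.2},
    P.underlyingGraph.auxGraph.Reachable p q →
      (Odd (P.underlyingGraph.auxGraph.dist p q) →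
        ¬ (P.arcs.Arc p.1.1 p.1.2 ∧ P.arcs.Arc q.1.1 q.1.2)) ∧
      (Even (P.underlyingGraph.auxGraph.dist p q) →
        (P.arcs.Arc p.1.1 p.1.2 ↔ P.arcs.Arc q.1.1 q.1.2))

/-- The adjacent pair `x`, `y` is oriented in `P`. -/
def IsOriented (P : PartiallyOrientedGraph V) (x y : V) : Prop := P.arcs.underlyingGraph.Adj x y

/-- `x, y, z` is a bad triple: a triangle of `G` whose three edges correspond to vertices from three
different connected components of `G⁺` and of which exactly two edges are oriented in `P`. -/
def IsBadTriple (P : PartiallyOrientedGraph V) (x y z : V) : Prop :=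
  ∃ (hxy : P.underlyingGraph.Adj x y) (hyz : P.underlyingGraph.Adj y z)
    (hzx : P.underlyingGraph.Adj z x),
    (P.underlyingGraph.edgeComponent hxy ≠ P.underlyingGraph.edgeComponent hyz ∧
      P.underlyingGraph.edgeComponent hyz ≠ P.underlyingGraph.edgeComponent hzx ∧
      P.underlyingGraph.edgeComponent hzx ≠ P.underlyingGraph.edgeComponent hxy) ∧
    ((P.IsOriented x y ∧ P.IsOriented y z ∧ ¬ P.IsOriented z x) ∨
      (P.IsOriented x y ∧ ¬ P.IsOriented y z ∧ P.IsOriented z x) ∨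
      (¬ P.IsOriented x y ∧ P.IsOriented y z ∧ P.IsOriented z x))

/-- `P` is friendly: it is consentaneous and has no bad triple. -/
def Friendly (P : PartiallyOrientedGraph V) : Prop :=
  P.Consentaneous ∧ ∀ x y z, ¬ P.IsBadTriple x y z

end PartiallyOrientedGraph

/-! Necessity: in a completion, the in- and out-neighbourhoods are transitive and contain those of
`P`. A non-universal cell also lies in one of them: connectedness gives an edge from `w` to `z` such
that `w` is adjacent to the whole cell and `z` to no vertex of it, so all arcs between `w` and the
cell have the same direction.

Sufficiency rests on the connected components of the complement of `G`. If `v` and `v'` are not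
adjacent, a common neighbour dominates exactly one of them. Hence a complement component with a
vertex outside it is bipartite, and after switching (reversing the arcs between vertices of
different sign) the arcs between two components depend only on the components. Since there are no
bad triples, comparability of components under these arcs is transitive. A further switching gives
every comparability class a vertex that dominates it. A directed triangle of components would then
be a dominated triangle, and undoing the switching would leave a directed triangle with a source or
a sink, which is excluded. So the arcs between components are a switched partial order
(`Friendly.exists_switched_order`), which extends to a linear order.

The completion uses this linear order between components, a linear order on pairs of similar
vertices in one component, and any orientation compatible with the forcing elsewhere. It is locally
transitive because a dominated or dominating directed triangle is an `IsObstruction`, a notion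
invariant under switching. By `IsObstruction.component_ne`, the four vertices of an obstruction lie
in four different complement components. There the orientation is a switched linear order, which has
no obstruction. -/

/-! ### Obstructions in local tournament orientations -/

/-- The relation `r` orients the simple graph `G` as a local tournament. -/
structure IsLocalTournamentOrientation {V : Type u} (G : SimpleGraph V) (r : V → V → Prop) :
    Prop where
  iff_not : ∀ {x y}, G.Adj x y → (r x y ↔ ¬ r y x)
  iff_of_not_adj : ∀ {u v w}, G.Adj u v → G.Adj u w → v ≠ w → ¬ G.Adj v w → (r u v ↔ r w u)

/-- Four pairwise adjacent vertices whose orientation is, up to switching, a directed triangle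
dominated by a vertex. The condition says that the Pfaffian of the sign matrix is `±3`. -/
structure IsObstruction {V : Type u} (G : SimpleGraph V) (r : V → V → Prop) (a b c d : V) :
    Prop where
  ab : G.Adj a b
  ac : G.Adj a c
  ad : G.Adj a d
  bc : G.Adj b c
  bd : G.Adj b d
  cd : G.Adj c d
  left : (r a b ↔ r c d) ↔ (r a c ↔ r d b)
  right : (r a c ↔ r d b) ↔ (r a d ↔ r b c)

namespace IsObstruction

variable {V : Type u} {G : SimpleGraph V} {r : V → V → Prop} {a b c d w : V}

/-- Transposing two vertices permutes the three terms of the Pfaffian up to a common sign, so an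
obstruction may be listed in any order. -/
theorem swap₁₂ (hr : IsLocalTournamentOrientation G r) (h : IsObstruction G r a b c d) :
    IsObstruction G r b a c d := by
  have h1 := hr.iff_not h.ab
  have h2 := hr.iff_not h.bd
  have h3 := hr.iff_not h.ad
  have := h.left
  have := h.right
  exact ⟨h.ab.symm, h.bc, h.bd, h.ac, h.ad, h.cd, by grind, by grind⟩

theorem swap₂₃ (hr : IsLocalTournamentOrientation G r) (h : IsObstruction G r a b c d) :
    IsObstruction G r a c b d := by
  have h1 := hr.iff_not h.bc
  have h2 := hr.iff_not h.bd
  have h3 := hr.iff_not h.cd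
  have := h.left
  have := h.right
  exact ⟨h.ac, h.ab, h.ad, h.bc.symm, h.cd, h.bd, by grind, by grind⟩

theorem swap₃₄ (hr : IsLocalTournamentOrientation G r) (h : IsObstruction G r a b c d) :
    IsObstruction G r a b d c := by
  have h1 := hr.iff_not h.bc
  have h2 := hr.iff_not h.bd
  have h3 := hr.iff_not h.cd
  have := h.left
  have := h.right
  exact ⟨h.ab, h.ad, h.ac, h.bd, h.bc, h.cd.symm, by grind, by grind⟩

theorem swap₁₃ (hr : IsLocalTournamentOrientation G r) (h : IsObstruction G r a b c d) :
    IsObstruction G r c b a d :=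
  ((h.swap₁₂ hr).swap₂₃ hr).swap₁₂ hr

/-- A vertex that is not adjacent to `a` and misses one of `c`, `d` but not `b` misses both, and
then `b` dominates, or is dominated by, the other three vertices. -/
theorem only_adj (hr : IsLocalTournamentOrientation G r) (h : IsObstruction G r a b c d)
    (hne : w ≠ a) (ha : ¬ G.Adj w a) (hb : G.Adj w b) (hcd : ¬ (G.Adj w c ∧ G.Adj w d)) :
    ¬ G.Adj w c ∧ ¬ G.Adj w d ∧ (r b a ↔ r b c) ∧ (r b a ↔ r b d) := by
  have e1 := hr.iff_not h.ab
  have e2 := hr.iff_not h.ac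
  have e3 := hr.iff_not h.ad
  have e4 := hr.iff_not h.bc
  have e5 := hr.iff_not h.bd
  have e6 := hr.iff_not h.cd
  have l := h.left
  have l' := h.right
  have wc : w ≠ c := by rintro rfl; exact ha h.ac.symm
  have wd : w ≠ d := by rintro rfl; exact ha h.ad.symm
  have key : ∀ {u x}, G.Adj u x → G.Adj w u → w ≠ x → ¬ G.Adj w x → (r u x ↔ r w u) :=
    fun h1 h2 h3 h4 => hr.iff_of_not_adj h1 h2.symm h3.symm fun h => h4 h.symm
  have f1 := key h.ab.symm hb hne ha
  have f2 := key h.bc hb wc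
  have f3 := key h.bd hb wd
  have f4 : G.Adj w c → _ := fun k => key h.ac.symm k hne ha
  have f5 : G.Adj w d → _ := fun k => key h.ad.symm k hne ha
  have f6 : G.Adj w c → ¬ G.Adj w d → _ := fun k k' => key h.cd k wd k'
  have f7 : G.Adj w d → ¬ G.Adj w c → _ := fun k k' => key h.cd.symm k wc k'
  by_cases k1 : G.Adj w c <;> by_cases k2 : G.Adj w d <;> grind

/-- By `only_adj`, `b` is a source or a sink and the other three vertices form a directed triangle.
If `v` misses `a`, then `v` can replace `a`, but with all its arcs reversed, so that `b` is no
longer a source or a sink. -/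
theorem eq_or_adj_of_only_adj (hr : IsLocalTournamentOrientation G r)
    (h : IsObstruction G r a b c d) (hne : w ≠ a) (ha : ¬ G.Adj w a) (hb : G.Adj w b)
    (hc : ¬ G.Adj w c) (hd : ¬ G.Adj w d) {v : V} (hv : G.Adj v c) : v = a ∨ G.Adj v a := by
  by_contra! hva
  obtain ⟨hva, hva'⟩ := hva
  have wc : w ≠ c := by rintro rfl; exact ha h.ac.symm
  have e := h.only_adj hr hne ha hb (by grind)
  -- Otherwise `only_adj` makes `c` a source or a sink as well, although `c` lies on the directed
  -- triangle.
  have vb : G.Adj v b := by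
    by_contra vb
    have e' := ((h.swap₂₃ hr)).only_adj hr hva hva' hv (by grind)
    have e1 := hr.iff_not h.ab
    have e2 := hr.iff_not h.ac
    have e3 := hr.iff_not h.ad
    have e4 := hr.iff_not h.bc
    have e5 := hr.iff_not h.bd
    have e6 := hr.iff_not h.cd
    have l := h.left
    have l' := h.right
    grind
  have vd : G.Adj v d := by
    by_contra vd
    have e' := h.only_adj hr hva hva' vb (by grind)
    exact e'.1 hv
  have key : ∀ {x}, G.Adj a x → G.Adj v x → (r x a ↔ r v x) :=
    fun h1 h2 => hr.iff_of_not_adj h1.symm h2.symm hva.symm fun h => hva' h.symm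
  have k1 := key h.ab vb
  have k2 := key h.ac hv
  have k3 := key h.ad vd
  have e1 := hr.iff_not h.ab
  have e2 := hr.iff_not h.ac
  have e3 := hr.iff_not h.ad
  have e4 := hr.iff_not vb
  have l := h.left
  have l' := h.right
  -- Non-adjacent `a` and `v` have opposite arcs to `b`, `c`, `d`; passing from one to the other is
  -- a switching at one vertex.
  have hv' : IsObstruction G r v b c d :=
    ⟨vb, hv, vd, h.bc, h.bd, h.cd, by grind, by grind⟩
  have e' := (hv'.swap₁₃ hr).only_adj hr wc hc hb (by grind)
  grind

theorem similar_of_only_adj (hr : IsLocalTournamentOrientation G r)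
    (h : IsObstruction G r a b c d) (hne : w ≠ a) (ha : ¬ G.Adj w a) (hb : G.Adj w b)
    (hc : ¬ G.Adj w c) (hd : ¬ G.Adj w d) : G.Similar a c := by
  have wc : w ≠ c := by rintro rfl; exact ha h.ac.symm
  ext v
  simp only [Set.mem_insert_iff, SimpleGraph.mem_neighborSet]
  constructor
  · rintro (rfl | hv)
    · exact Or.inr h.ac.symm
    · exact ((h.swap₁₃ hr).eq_or_adj_of_only_adj hr wc hc hb ha hd hv.symm).imp_right (·.symm)
  · rintro (rfl | hv)
    · exact Or.inr h.ac
    · exact (h.eq_or_adj_of_only_adj hr hne ha hb hc hd hv.symm).imp_right (·.symm)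

/-- The vertices `a`, `c`, `d` are pairwise similar and form a directed triangle. The hypothesis
`hcell` excludes this, `w` witnessing that they are not universal. -/
theorem false_of_only_adj (hr : IsLocalTournamentOrientation G r)
    (hcell : ∀ x y z w, w ≠ x → ¬ G.Adj w x → G.Similar x y → G.Similar x z →
      r x y → r y z → ¬ r z x)
    (h : IsObstruction G r a b c d) (hne : w ≠ a) (ha : ¬ G.Adj w a) (hb : G.Adj w b)
    (hcd : ¬ (G.Adj w c ∧ G.Adj w d)) : False := by
  obtain ⟨hc, hd, k1, k2⟩ := h.only_adj hr hne ha hb hcd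
  have sac := h.similar_of_only_adj hr hne ha hb hc hd
  have sad := (h.swap₃₄ hr).similar_of_only_adj hr hne ha hb hd hc
  have c1 := hcell a c d w hne ha sac sad
  have c2 := hcell a d c w hne ha sad sac
  have e1 := hr.iff_not h.ab
  have e2 := hr.iff_not h.ac
  have e3 := hr.iff_not h.ad
  have e4 := hr.iff_not h.bc
  have e5 := hr.iff_not h.bd
  have e6 := hr.iff_not h.cd
  have l := h.left
  have l' := h.right
  grind

/-- A vertex not adjacent to any vertex of an obstruction has a neighbour that is adjacent to none
of them. -/
theorem not_adj_of_adj (hr : IsLocalTournamentOrientation G r)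
    (hcell : ∀ x y z w, w ≠ x → ¬ G.Adj w x → G.Similar x y → G.Similar x z →
      r x y → r y z → ¬ r z x)
    (h : IsObstruction G r a b c d) (ha : ¬ G.Adj w a) (hb : ¬ G.Adj w b) (hc : ¬ G.Adj w c)
    (hd : ¬ G.Adj w d) {v : V} (hv : G.Adj w v) : ¬ G.Adj v a := by
  intro va
  have wa : w ≠ a := by rintro rfl; exact hb h.ab
  have wb : w ≠ b := by rintro rfl; exact ha h.ab.symm
  have wc : w ≠ c := by rintro rfl; exact ha h.ac.symm
  have wd : w ≠ d := by rintro rfl; exact ha h.ad.symm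
  have key : ∀ {x}, G.Adj v x → w ≠ x → ¬ G.Adj w x → (r v x ↔ r w v) :=
    fun h1 h2 h3 => hr.iff_of_not_adj h1 hv.symm h2.symm fun h => h3 h.symm
  -- If `v` missed `b`, it would be adjacent to `c` and `d` and could replace `b` in the
  -- obstruction; `w` would then be adjacent to `v` only, contradicting `false_of_only_adj`.
  have vx : ∀ {a b c d}, IsObstruction G r a b c d → w ≠ a → w ≠ b → ¬ G.Adj w a →
      ¬ G.Adj w b → ¬ G.Adj w c → ¬ G.Adj w d → G.Adj v a → G.Adj v b := by
    intro a b c d h wa wb ha hb hc hd va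
    by_contra vb
    have vb' : v ≠ b := by rintro rfl; exact hb hv
    have k := fun hcd => (h.swap₁₂ hr).false_of_only_adj hr hcell vb' vb va hcd
    rw [imp_false, not_not] at k
    have k1 := key va wa ha
    have k2 := key k.1 (by rintro rfl; exact ha h.ac.symm) hc
    have k3 := key k.2 (by rintro rfl; exact ha h.ad.symm) hd
    have e : ∀ {x}, G.Adj v x → G.Adj b x → (r x b ↔ r v x) :=
      fun h1 h2 => hr.iff_of_not_adj h2.symm h1.symm vb'.symm fun h => vb h.symm
    have m1 := e va h.ab.symm
    have m2 := e k.1 h.bc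
    have m3 := e k.2 h.bd
    have e1 := hr.iff_not va
    have e2 := hr.iff_not h.bc
    have e3 := hr.iff_not h.bd
    have e4 := hr.iff_not h.ab
    have e5 := hr.iff_not k.2
    have l := h.left
    have l' := h.right
    have hv' : IsObstruction G r a v c d :=
      ⟨va.symm, h.ac, h.ad, k.1, k.2, h.cd, by clear hcell key e; grind,
        by clear hcell key e; grind⟩
    exact hv'.false_of_only_adj hr hcell wa ha hv (by grind)
  have vb := vx h wa wb ha hb hc hd va
  have vc := vx (h.swap₂₃ hr) wa wc ha hc hb hd va
  have vd := vx ((h.swap₃₄ hr).swap₂₃ hr) wa wd ha hd hb hc va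
  have k1 := key va wa ha
  have k2 := key vb wb hb
  have k3 := key vc wc hc
  have k4 := key vd wd hd
  -- By `key`, `v` is a source or a sink over all four vertices. As `v` forms no obstruction with
  -- any three of them, no three form a directed triangle; the four are then transitively oriented
  -- and are no obstruction.
  have n1 : ¬ IsObstruction G r a v b c :=
    fun h => h.false_of_only_adj hr hcell wa ha hv (by grind)
  have n2 : ¬ IsObstruction G r a v b d :=
    fun h => h.false_of_only_adj hr hcell wa ha hv (by grind)
  have n3 : ¬ IsObstruction G r a v c d :=
    fun h => h.false_of_only_adj hr hcell wa ha hv (by grind)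
  have n4 : ¬ IsObstruction G r b v c d :=
    fun h => h.false_of_only_adj hr hcell wb hb hv (by grind)
  have e0 := hr.iff_not va
  have e1 := hr.iff_not h.ab
  have e2 := hr.iff_not h.ac
  have e3 := hr.iff_not h.ad
  have e4 := hr.iff_not h.bc
  have e5 := hr.iff_not h.bd
  have e6 := hr.iff_not h.cd
  have e7 := hr.iff_not vb
  have e8 := hr.iff_not vc
  have e9 := hr.iff_not vd
  have l := h.left
  have l' := h.right
  have m1 : ¬ (((r a v ↔ r b c) ↔ (r a b ↔ r c v)) ∧
      ((r a b ↔ r c v) ↔ (r a c ↔ r v b))) :=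
    fun k => n1 ⟨va.symm, h.ab, h.ac, vb, vc, h.bc, k.1, k.2⟩
  have m2 : ¬ (((r a v ↔ r b d) ↔ (r a b ↔ r d v)) ∧
      ((r a b ↔ r d v) ↔ (r a d ↔ r v b))) :=
    fun k => n2 ⟨va.symm, h.ab, h.ad, vb, vd, h.bd, k.1, k.2⟩
  have m3 : ¬ (((r a v ↔ r c d) ↔ (r a c ↔ r d v)) ∧
      ((r a c ↔ r d v) ↔ (r a d ↔ r v c))) :=
    fun k => n3 ⟨va.symm, h.ac, h.ad, vc, vd, h.cd, k.1, k.2⟩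
  have m4 : ¬ (((r b v ↔ r c d) ↔ (r b c ↔ r d v)) ∧
      ((r b c ↔ r d v) ↔ (r b d ↔ r v c))) :=
    fun k => n4 ⟨vb.symm, h.bc, h.bd, vc, vd, h.cd, k.1, k.2⟩
  clear n1 n2 n3 n4 hcell key vx
  grind

/-- No vertex misses all four vertices of an obstruction. -/
theorem exists_adj (hr : IsLocalTournamentOrientation G r) (hG : G.Connected)
    (hcell : ∀ x y z w, w ≠ x → ¬ G.Adj w x → G.Similar x y → G.Similar x z →
      r x y → r y z → ¬ r z x)
    (h : IsObstruction G r a b c d) (w : V) :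
    G.Adj w a ∨ G.Adj w b ∨ G.Adj w c ∨ G.Adj w d := by
  by_contra hw
  -- Some edge on a walk from `w` to `a` leaves the set of vertices that miss all four; `a` is
  -- outside this set because of its neighbour `b`.
  obtain ⟨⟨⟨x, y⟩, hadj⟩, -, hx, hy⟩ := (hG.preconnected w a).some.exists_boundary_dart
    {v | ¬ (G.Adj v a ∨ G.Adj v b ∨ G.Adj v c ∨ G.Adj v d)} hw (by simp [h.ab])
  simp only [Set.mem_ofPred_eq, not_or] at hx hy
  obtain ⟨ha, hb, hc, hd⟩ := hx
  have n1 := h.not_adj_of_adj hr hcell ha hb hc hd hadj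
  have n2 := (h.swap₁₂ hr).not_adj_of_adj hr hcell hb ha hc hd hadj
  have n3 := (h.swap₁₃ hr).not_adj_of_adj hr hcell hc hb ha hd hadj
  have n4 := ((h.swap₃₄ hr).swap₁₃ hr).not_adj_of_adj hr hcell hd hb ha hc hadj
  tauto

/-- By `false_of_only_adj`, `w` is adjacent to all or none of `b`, `c`, `d`, and `exists_adj`
excludes none. Then `w` is a switched copy of `a`. -/
theorem replace_of_not_adj (hr : IsLocalTournamentOrientation G r) (hG : G.Connected)
    (hcell : ∀ x y z w, w ≠ x → ¬ G.Adj w x → G.Similar x y → G.Similar x z →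
      r x y → r y z → ¬ r z x)
    (h : IsObstruction G r a b c d) (hne : w ≠ a) (ha : ¬ G.Adj w a) :
    IsObstruction G r w b c d := by
  have k : G.Adj w b ∧ G.Adj w c ∧ G.Adj w d := by
    have f1 := fun hb hcd => h.false_of_only_adj hr hcell hne ha hb hcd
    have f2 := fun hb hcd => (h.swap₂₃ hr).false_of_only_adj hr hcell hne ha hb hcd
    have f3 := fun hb hcd =>
      ((h.swap₃₄ hr).swap₂₃ hr).false_of_only_adj hr hcell hne ha hb hcd
    have f4 := h.exists_adj hr hG hcell w
    tauto
  obtain ⟨wb, wc, wd⟩ := k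
  have key : ∀ {x}, G.Adj a x → G.Adj w x → (r x a ↔ r w x) :=
    fun h1 h2 => hr.iff_of_not_adj h1.symm h2.symm hne.symm fun h => ha h.symm
  have k1 := key h.ab wb
  have k2 := key h.ac wc
  have k3 := key h.ad wd
  have e1 := hr.iff_not h.ab
  have e2 := hr.iff_not h.ac
  have e3 := hr.iff_not h.ad
  have l := h.left
  have l' := h.right
  clear hcell key
  exact ⟨wb, wc, wd, h.bc, h.bd, h.cd, by grind, by grind⟩

theorem replace_of_reachable (hr : IsLocalTournamentOrientation G r) (hG : G.Connected)
    (hcell : ∀ x y z w, w ≠ x → ¬ G.Adj w x → G.Similar x y → G.Similar x z →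
      r x y → r y z → ¬ r z x)
    (h : IsObstruction G r a b c d) (hw : Gᶜ.Reachable a w) : IsObstruction G r w b c d := by
  obtain ⟨p⟩ := hw
  induction p with
  | nil => exact h
  | cons hadj _ ih =>
    rw [SimpleGraph.compl_adj] at hadj
    exact ih (h.replace_of_not_adj hr hG hcell hadj.1.symm fun h => hadj.2 h.symm)

/-- Otherwise `a` could be moved along a complement path until it coincides with `b`, making `b`
adjacent to itself. -/
theorem component_ne (hr : IsLocalTournamentOrientation G r) (hG : G.Connected)
    (hcell : ∀ x y z w, w ≠ x → ¬ G.Adj w x → G.Similar x y → G.Similar x z →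
      r x y → r y z → ¬ r z x)
    (h : IsObstruction G r a b c d) :
    Gᶜ.connectedComponentMk a ≠ Gᶜ.connectedComponentMk b := fun hab =>
  (h.replace_of_reachable hr hG hcell (SimpleGraph.ConnectedComponent.exact hab)).ab.ne rfl

end IsObstruction

/-! ### Local tournaments, local transitivity and directed cycles -/

namespace OrientedGraph

variable {V : Type u} {D : OrientedGraph V}

theorem IsLocalTournament.isLocalTournamentOrientation (hD : D.IsLocalTournament) :
    IsLocalTournamentOrientation D.underlyingGraph D.Arc where
  iff_not := by
    intro x y h
    have := D.asymm x y
    have := D.asymm y x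
    change D.Arc x y ∨ D.Arc y x at h
    tauto
  iff_of_not_adj := by
    intro u v w huv huw hvw hn
    change D.Arc u v ∨ D.Arc v u at huv
    change D.Arc u w ∨ D.Arc w u at huw
    have := fun h1 h2 => hn ((hD u).1 v h1 w h2 hvw)
    have := fun h1 h2 => hn ((hD u).2 v h1 w h2 hvw)
    have := D.asymm u v
    have := D.asymm u w
    simp only [inNbhd, outNbhd, Set.mem_ofPred_eq] at *
    tauto

theorem isLocalTournament_of_orientation
    (h : IsLocalTournamentOrientation D.underlyingGraph D.Arc) : D.IsLocalTournament := by
  refine fun v => ⟨fun x hx y hy hxy => ?_, fun x hx y hy hxy => ?_⟩ <;> by_contra hn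
  · have := h.iff_of_not_adj (Or.inr hx) (Or.inr hy) hxy hn
    exact D.asymm v x (this.2 hy) hx
  · have := h.iff_of_not_adj (Or.inl hx) (Or.inl hy) hxy hn
    exact D.asymm v y hy (this.1 hx)

theorem isLocallyTransitive_of_forall_not_isObstruction (hD : D.IsLocalTournament)
    (h : ∀ a b c d, ¬ IsObstruction D.underlyingGraph D.Arc a b c d) :
    D.IsLocallyTransitive := by
  refine fun v => ⟨⟨(hD v).1, fun x hx y hy z hz hxy hyz => ?_⟩,
    ⟨(hD v).2, fun x hx y hy z hz hxy hyz => ?_⟩⟩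
  · have hxz : x ≠ z := by rintro rfl; exact D.asymm _ _ hxy hyz
    refine ((hD v).1 x hx z hz hxz).resolve_right fun hzx => h v x y z ?_
    simp only [inNbhd, Set.mem_ofPred_eq] at hx hy hz
    have := D.asymm _ _ hx
    have := D.asymm _ _ hy
    have := D.asymm _ _ hz
    exact ⟨Or.inr hx, Or.inr hy, Or.inr hz, Or.inl hxy, Or.inr hzx, Or.inl hyz,
      by tauto, by tauto⟩
  · have hxz : x ≠ z := by rintro rfl; exact D.asymm _ _ hxy hyz
    refine ((hD v).2 x hx z hz hxz).resolve_right fun hzx => h v x y z ?_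
    simp only [outNbhd, Set.mem_ofPred_eq] at hx hy hz
    exact ⟨Or.inl hx, Or.inl hy, Or.inl hz, Or.inl hxy, Or.inr hzx, Or.inl hyz,
      by tauto, by tauto⟩

theorem hasDirectedCycleIn_of_triangle {S : Set V} {x y z : V} (hx : x ∈ S) (hy : y ∈ S)
    (hz : z ∈ S) (hxy : D.Arc x y) (hyz : D.Arc y z) (hzx : D.Arc z x) :
    D.HasDirectedCycleIn S := by
  have h1 : ∀ {a b}, D.Arc a b → a ≠ b := by rintro a _ h rfl; exact D.asymm _ _ h h
  refine ⟨2, ![x, y, z], ?_, ?_, ?_⟩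
  · intro i j
    have := h1 hxy
    have := h1 hyz
    have := h1 hzx
    fin_cases i <;> fin_cases j <;> simp <;> grind
  · intro i
    fin_cases i <;> simpa
  · intro i
    fin_cases i <;> simpa

/-- A vertex set inducing a transitive tournament contains no directed cycle. -/
theorem not_hasDirectedCycleIn_of_trans {S : Set V}
    (hS : ∀ x ∈ S, ∀ y ∈ S, ∀ z ∈ S, D.Arc x y → D.Arc y z → D.Arc x z) :
    ¬ D.HasDirectedCycleIn S := by
  rintro ⟨n, c, -, hc, harc⟩
  have h : ∀ k (hk : k < n + 1), D.Arc (c 0) (c (⟨k, hk⟩ + 1)) := by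
    intro k
    induction k with
    | zero => intro hk; exact harc _
    | succ k ih =>
      intro hk
      have e : (⟨k, by omega⟩ + 1 : Fin (n + 1)) = ⟨k + 1, hk⟩ := by
        ext
        simp [Fin.val_add, Nat.mod_eq_of_lt hk]
      have := ih (by omega)
      rw [e] at this
      exact hS _ (hc _) _ (hc _) _ (hc _) this (harc _)
  have := h n (by omega)
  rw [show (⟨n, by omega⟩ + 1 : Fin (n + 1)) = 0 by ext; simp [Fin.val_add]] at this
  exact D.asymm _ _ this this

end OrientedGraph

/-! ### Components of the complement and of the auxiliary graph -/

namespace SimpleGraph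

variable {V : Type u} {G : SimpleGraph V}

theorem adj_of_component_ne {x y : V}
    (h : Gᶜ.connectedComponentMk x ≠ Gᶜ.connectedComponentMk y) : G.Adj x y := by
  by_contra hn
  refine h (ConnectedComponent.sound ?_)
  by_cases hxy : x = y
  · rw [hxy]
  · exact (((G.compl_adj x y).2 ⟨hxy, hn⟩).reachable)

theorem component_eq_of_not_adj {x y : V} (h : ¬ G.Adj x y) :
    Gᶜ.connectedComponentMk x = Gᶜ.connectedComponentMk y :=
  not_not.1 fun hn => h (adj_of_component_ne hn)

theorem Similar.adj_iff {x y w : V} (h : G.Similar x y) (hx : w ≠ x) (hy : w ≠ y) :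
    G.Adj x w ↔ G.Adj y w := by
  have := Set.ext_iff.1 h w
  simpa [hx, hy] using this

theorem Similar.adj {x y : V} (h : G.Similar x y) (hxy : x ≠ y) : G.Adj x y := by
  have := (Set.ext_iff.1 h y).2 (by simp)
  simpa [hxy.symm] using this

/-- A function of edges that takes equal values on any two edges `uv`, `uw` with `v`, `w` not
adjacent depends only on the component of the auxiliary graph. -/
theorem eq_of_edgeComponent_eq {α : Type*} {f : V → V → α} (hsymm : ∀ x y, f x y = f y x)
    (hf : ∀ u v w, G.Adj u v → G.Adj u w → v ≠ w → ¬ G.Adj v w → f u v = f u w)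
    {x y x' y' : V} {h : G.Adj x y} {h' : G.Adj x' y'}
    (he : G.edgeComponent h = G.edgeComponent h') : f x y = f x' y' := by
  have key : ∀ p q : {p : V × V // G.Adj p.1 p.2}, G.auxGraph.Adj p q →
      f p.1.1 p.1.2 = f q.1.1 q.1.2 := by
    rintro ⟨⟨a, b⟩, hab⟩ ⟨⟨a', b'⟩, hab'⟩ ⟨hne, h⟩
    simp only [ne_eq, Subtype.mk.injEq, Prod.mk.injEq, not_and] at *
    rcases h with ⟨h1, h2⟩ | ⟨h1, h2⟩ | ⟨h1, h2⟩
    · subst h1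
      exact hf _ _ _ hab hab' (hne rfl) h2
    · subst h2
      rw [hsymm a, hsymm a']
      exact hf _ _ _ hab.symm hab'.symm (fun h => hne h rfl) h1
    · subst h1 h2
      exact hsymm _ _
  obtain ⟨p⟩ := ConnectedComponent.exact he
  have : ∀ {p q}, G.auxGraph.Walk p q → f p.1.1 p.1.2 = f q.1.1 q.1.2 := by
    intro p q w
    induction w with
    | nil => rfl
    | cons hadj _ ih => exact (key _ _ hadj).trans ih
  exact this p

/-- A step in the auxiliary graph reverses an edge or moves one end to a non-adjacent vertex, hence
within its complement component. -/
theorem component_eq_of_edgeComponent_eq {x y x' y' : V} {h : G.Adj x y} {h' : G.Adj x' y'}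
    (he : G.edgeComponent h = G.edgeComponent h') :
    s(Gᶜ.connectedComponentMk x, Gᶜ.connectedComponentMk y) =
      s(Gᶜ.connectedComponentMk x', Gᶜ.connectedComponentMk y') :=
  eq_of_edgeComponent_eq
    (f := fun x y => s(Gᶜ.connectedComponentMk x, Gᶜ.connectedComponentMk y))
    (fun _ _ => Sym2.eq_swap)
    (fun u v w _ _ _ hn => by simp only [component_eq_of_not_adj hn]) he

/-- No vertex is adjacent to exactly one of two similar vertices, so the only step from `(x, y)` is
its reversal. -/
theorem Similar.eq_of_edgeComponent_eq {x y x' y' : V} (hs : G.Similar x y) {h : G.Adj x y}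
    {h' : G.Adj x' y'} (he : G.edgeComponent h = G.edgeComponent h') : s(x', y') = s(x, y) := by
  have hsim : ∀ {u v w}, G.Adj u w → v ≠ w → ¬ G.Adj v w → s(u, v) ≠ s(x, y) := by
    intro u v w huw hvw hn huv
    rcases Sym2.eq_iff.1 huv with ⟨rfl, rfl⟩ | ⟨rfl, rfl⟩
    · exact hn ((hs.adj_iff huw.ne' hvw.symm).1 huw)
    · exact hn ((hs.adj_iff hvw.symm huw.ne').2 huw)
  have := SimpleGraph.eq_of_edgeComponent_eq (f := fun u v => s(u, v) = s(x, y))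
    (fun _ _ => by rw [Sym2.eq_swap])
    (fun u v w huv huw hvw hn => by
      rw [eq_iff_iff]
      exact iff_of_false (hsim huw hvw hn) (hsim huv hvw.symm fun h => hn h.symm)) he
  simpa using this

end SimpleGraph

namespace IsLocalTournamentOrientation

variable {V : Type u} {G : SimpleGraph V} {r : V → V → Prop}

open Classical in
/-- A local tournament orientation yields a proper `2`-colouring of the auxiliary graph. -/
noncomputable def auxColoring (hr : IsLocalTournamentOrientation G r) :
    G.auxGraph.Coloring Bool :=
  SimpleGraph.Coloring.mk (fun p => decide (r p.1.1 p.1.2)) <| by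
    rintro ⟨⟨a, b⟩, hab⟩ ⟨⟨a', b'⟩, hab'⟩ ⟨hne, h⟩
    simp only [ne_eq, Subtype.mk.injEq, Prod.mk.injEq, not_and, decide_eq_decide] at *
    have e := hr.iff_not hab
    have e' := hr.iff_not hab'
    rcases h with ⟨h1, h2⟩ | ⟨h1, h2⟩ | ⟨h1, h2⟩
    · subst h1
      have := hr.iff_of_not_adj hab hab' (hne rfl) h2
      tauto
    · subst h2
      have := hr.iff_of_not_adj hab.symm hab'.symm (fun h => hne h rfl) h1
      tauto
    · subst h1 h2
      tauto

end IsLocalTournamentOrientation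

/-! ### Consequences of friendliness -/

namespace PartiallyOrientedGraph

variable {V : Type u} {P : PartiallyOrientedGraph V}

theorem Consentaneous.arc_iff (hP : P.Consentaneous) {r : V → V → Prop}
    (hr : IsLocalTournamentOrientation P.underlyingGraph r) {u v w : V}
    (huv : P.underlyingGraph.Adj u v) (huw : P.underlyingGraph.Adj u w) (hvw : v ≠ w)
    (hn : ¬ P.underlyingGraph.Adj v w) : P.arcs.Arc u v ↔ P.arcs.Arc w u := by
  classical
  let p : {p : V × V // P.underlyingGraph.Adj p.1 p.2} := ⟨(u, v), huv⟩
  let q : {p : V × V // P.underlyingGraph.Adj p.1 p.2} := ⟨(u, w), huw⟩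
  let q' : {p : V × V // P.underlyingGraph.Adj p.1 p.2} := ⟨(w, u), huw.symm⟩
  have h1 : P.underlyingGraph.auxGraph.Adj p q :=
    ⟨by simp [p, q, hvw], Or.inl ⟨rfl, hn⟩⟩
  have h2 : P.underlyingGraph.auxGraph.Adj q q' :=
    ⟨by simp [q, q', huw.ne], Or.inr (Or.inr ⟨rfl, rfl⟩)⟩
  have hpq := h1.reachable.trans h2.reachable
  -- The walk through `q` has length two; since the auxiliary graph is bipartite, a shortest walk
  -- has the same parity.
  obtain ⟨W, hW⟩ := hpq.exists_walk_length_eq_dist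
  refine (hP p q' hpq).2 ?_
  rw [← hW, hr.auxColoring.even_length_iff_congr]
  have c1 := hr.auxColoring.valid h1
  have c2 := hr.auxColoring.valid h2
  generalize hr.auxColoring p = a at *
  generalize hr.auxColoring q = b at *
  generalize hr.auxColoring q' = c at *
  revert a b c
  decide

theorem Friendly.isOriented_of_triangle (hP : P.Friendly) {x y z : V}
    (hxy : P.underlyingGraph.Adj x y) (hyz : P.underlyingGraph.Adj y z)
    (hzx : P.underlyingGraph.Adj z x)
    (h1 : P.underlyingGraph.edgeComponent hxy ≠ P.underlyingGraph.edgeComponent hyz)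
    (h2 : P.underlyingGraph.edgeComponent hyz ≠ P.underlyingGraph.edgeComponent hzx)
    (h3 : P.underlyingGraph.edgeComponent hzx ≠ P.underlyingGraph.edgeComponent hxy)
    (oxy : P.IsOriented x y) (oyz : P.IsOriented y z) : P.IsOriented z x := by
  by_contra ozx
  exact hP.2 x y z ⟨hxy, hyz, hzx, ⟨h1, h2, h3⟩, Or.inl ⟨oxy, oyz, ozx⟩⟩

/-- The three edges join different pairs of complement components, so they lie in different
components of the auxiliary graph. This makes comparability of complement components transitive. -/
theorem Friendly.isOriented_of_component_ne (hP : P.Friendly) {x y z : V}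
    (hxy : P.underlyingGraphᶜ.connectedComponentMk x ≠ P.underlyingGraphᶜ.connectedComponentMk y)
    (hyz : P.underlyingGraphᶜ.connectedComponentMk y ≠ P.underlyingGraphᶜ.connectedComponentMk z)
    (hzx : P.underlyingGraphᶜ.connectedComponentMk z ≠ P.underlyingGraphᶜ.connectedComponentMk x)
    (oxy : P.IsOriented x y) (oyz : P.IsOriented y z) : P.IsOriented z x := by
  refine hP.isOriented_of_triangle (SimpleGraph.adj_of_component_ne hxy)
    (SimpleGraph.adj_of_component_ne hyz) (SimpleGraph.adj_of_component_ne hzx) ?_ ?_ ?_ oxy oyz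
  all_goals
    intro he
    have := SimpleGraph.component_eq_of_edgeComponent_eq he
    rw [Sym2.eq_iff] at this
    tauto

theorem Friendly.isOriented_of_similar (hP : P.Friendly) {x y z : V}
    (sxy : P.underlyingGraph.Similar x y) (syz : P.underlyingGraph.Similar y z)
    (hxy : x ≠ y) (hyz : y ≠ z) (hzx : z ≠ x)
    (oxy : P.IsOriented x y) (oyz : P.IsOriented y z) : P.IsOriented z x := by
  have szx : P.underlyingGraph.Similar z x := (sxy.trans syz).symm
  refine hP.isOriented_of_triangle (sxy.adj hxy) (syz.adj hyz) (szx.adj hzx) ?_ ?_ ?_ oxy oyz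
  all_goals
    intro he
    have := SimpleGraph.Similar.eq_of_edgeComponent_eq (by assumption) he
    rw [Sym2.eq_iff] at this
    tauto

end PartiallyOrientedGraph

/-! ### Linear extensions and switching -/

/-- A strict partial order extends to a strict linear order. -/
theorem exists_strict_linear_extension {α : Type*} (s : α → α → Prop) (hirr : ∀ x, ¬ s x x)
    (htrans : ∀ x y z, s x y → s y z → s x z) :
    ∃ l : α → α → Prop, (∀ x y, s x y → l x y) ∧ (∀ x y z, l x y → l y z → l x z) ∧
      ∀ x y, x ≠ y → (l x y ↔ ¬ l y x) := by
  have hpo : IsPartialOrder α fun x y => x = y ∨ s x y :=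
    { refl := fun x => Or.inl rfl
      trans := by
        rintro x y z (rfl | h) (rfl | h')
        exacts [Or.inl rfl, Or.inr h', Or.inr h, Or.inr (htrans _ _ _ h h')]
      antisymm := by
        rintro x y (rfl | h) (h' | h')
        exacts [rfl, rfl, h'.symm, (hirr _ (htrans _ _ _ h h')).elim] }
  obtain ⟨t, ht, hle⟩ := extend_partialOrder fun x y => x = y ∨ s x y
  refine ⟨fun x y => t x y ∧ x ≠ y, fun x y h => ⟨hle _ _ (Or.inr h), ?_⟩, ?_, ?_⟩
  · rintro rfl
    exact hirr _ h
  · rintro x y z ⟨h, hne⟩ ⟨h', -⟩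
    refine ⟨ht.trans _ _ _ h h', ?_⟩
    rintro rfl
    exact hne (ht.antisymm _ _ h h')
  · intro x y hne
    constructor
    · rintro ⟨h, -⟩ ⟨h', -⟩
      exact hne (ht.antisymm _ _ h h')
    · intro h
      exact ⟨(ht.total x y).resolve_right fun h' => h ⟨h', hne.symm⟩, hne⟩

/-- The relation obtained from `A` by reversing it between elements of different sign. -/
def switchRel {α : Type*} (s : α → Bool) (A : α → α → Prop) (x y : α) : Prop :=
  (s x = s y ∧ A x y) ∨ (s x ≠ s y ∧ A y x)

theorem switchRel_or_switchRel {α : Type*} {s : α → Bool} {A : α → α → Prop} {x y : α} :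
    switchRel s A x y ∨ switchRel s A y x ↔ A x y ∨ A y x := by
  unfold switchRel
  cases s x <;> cases s y <;> simp [or_comm]

theorem switchRel_asymm {α : Type*} {s : α → Bool} {A : α → α → Prop} {x y : α}
    (hA : A x y → ¬ A y x) (h : switchRel s A x y) : ¬ switchRel s A y x := by
  have : s x = s y ↔ s y = s x := eq_comm
  unfold switchRel at *
  tauto

/-- Each of the four signs occurs once in every Pfaffian term, so switching multiplies all terms by
the same sign. -/
theorem iff_of_switch {p q r t : Bool} {A B C D : Prop}
    (h : (((p = q) ↔ A) ↔ ((r = t) ↔ B)) ↔ (((p = r) ↔ C) ↔ ((t = q) ↔ D))) :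
    (A ↔ B) ↔ (C ↔ D) := by
  by_cases hA : A <;> by_cases hB : B <;> by_cases hC : C <;> by_cases hD : D <;>
    simp only [hA, hB, hC, hD] at h ⊢ <;> revert p q r t <;> decide

theorem iff_of_switch' {p q r t : Bool} {A B C D : Prop}
    (h : (((p = r) ↔ A) ↔ ((t = q) ↔ B)) ↔ (((p = t) ↔ C) ↔ ((q = r) ↔ D))) :
    (A ↔ B) ↔ (C ↔ D) := by
  by_cases hA : A <;> by_cases hB : B <;> by_cases hC : C <;> by_cases hD : D <;>
    simp only [hA, hB, hC, hD] at h ⊢ <;> revert p q r t <;> decide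

/-- Switching a linear order does not create an obstruction. -/
theorem not_isObstruction_switchRel {V : Type u} {G : SimpleGraph V} {α : Type*} {f : V → α}
    {l : α → α → Prop} (htrans : ∀ x y z, l x y → l y z → l x z)
    (hl : ∀ x y, x ≠ y → (l x y ↔ ¬ l y x)) {s : V → Bool} {a b c d : V} (hab : f a ≠ f b)
    (hac : f a ≠ f c) (had : f a ≠ f d) (hbc : f b ≠ f c) (hbd : f b ≠ f d) (hcd : f c ≠ f d) :
    ¬ IsObstruction G (switchRel s fun x y => l (f x) (f y)) a b c d := by
  have hsw : ∀ {x y}, (l (f x) (f y) ↔ ¬ l (f y) (f x)) →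
      (switchRel s (fun x y => l (f x) (f y)) x y ↔ ((s x = s y) ↔ l (f x) (f y))) := by
    intro x y h
    by_cases hs : s x = s y <;> simp [switchRel, hs, h]
  intro h
  have h1 := h.left
  have h2 := h.right
  have e1 := hl _ _ hab
  have e2 := hl _ _ hac
  have e3 := hl _ _ had
  have e4 := hl _ _ hbc
  have e5 := hl _ _ hbd
  have e6 := hl _ _ hcd
  rw [hsw e1, hsw e6, hsw e2, hsw (hl _ _ hbd.symm)] at h1
  rw [hsw e3, hsw e4, hsw e2, hsw (hl _ _ hbd.symm)] at h2
  have l1 := iff_of_switch h1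
  have l2 := iff_of_switch' h2
  clear h1 h2 hsw h hl
  generalize f a = a at *
  generalize f b = b at *
  generalize f c = c at *
  generalize f d = d at *
  have t1 := htrans a b c
  have t2 := htrans a b d
  have t3 := htrans a c d
  have t4 := htrans b c d
  have t1' := htrans c b a
  have t2' := htrans d b a
  have t3' := htrans d c a
  have t4' := htrans d c b
  have t5 := htrans b c a
  have t6 := htrans b d a
  have t7 := htrans c d a
  have t8 := htrans c d b
  have t9 := htrans a c b
  have t10 := htrans a d b
  have t11 := htrans a d c
  have t12 := htrans b d c
  clear htrans
  grind

/-- A partial tournament whose comparability relation is transitive can be switched so that every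
comparability class has a vertex dominating the whole class. -/
theorem exists_switchRel_dominating {α : Type*} (T : α → α → Prop)
    (htrans : ∀ x y z, x ≠ z → T x y ∨ T y x → T y z ∨ T z y → T x z ∨ T z x) :
    ∃ t : α → Bool, ∀ x, ∃ r, ∀ y, y = x ∨ T x y ∨ T y x → y = r ∨ switchRel t T r y := by
  classical
  let S : Setoid α :=
    { r := fun x y => x = y ∨ T x y ∨ T y x
      iseqv :=
        { refl := fun x => Or.inl rfl
          symm := by
            rintro x y (h | h)
            exacts [Or.inl h.symm, Or.inr h.symm]
          trans := by
            rintro x y z (rfl | h) (rfl | h')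
            · exact Or.inl rfl
            · exact Or.inr h'
            · exact Or.inr h
            · by_cases hxz : x = z
              · exact Or.inl hxz
              · exact Or.inr (htrans _ _ _ hxz h h') } }
  let ρ : α → α := fun x => (Quotient.mk S x).out
  have hρ : ∀ x y, S x y → ρ x = ρ y := fun x y h => congrArg Quotient.out (Quotient.sound h)
  have hρ' : ∀ x, S (ρ x) x := fun x => Quotient.mk_out x
  have hρρ : ∀ x, ρ (ρ x) = ρ x := fun x => hρ _ _ (hρ' x)
  -- The switching reverses exactly the relations between the representative of a class and the
  -- elements that dominate it, besides others not involving the representative.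
  refine ⟨fun x => decide (ρ x = x ∨ T (ρ x) x), fun x => ⟨ρ x, fun y hy => ?_⟩⟩
  have hxy : S x y := by
    change x = y ∨ T x y ∨ T y x
    exact hy.imp_left Eq.symm
  have h := hρ' y
  rw [← hρ x y hxy] at h
  change ρ x = y ∨ T (ρ x) y ∨ T y (ρ x) at h
  unfold switchRel
  simp only [hρρ, ← hρ x y hxy, true_or, decide_true]
  by_cases h1 : ρ x = y
  · exact Or.inl h1.symm
  · by_cases h2 : T (ρ x) y
    · exact Or.inr (Or.inl ⟨by simp [h2], h2⟩)
    · exact Or.inr (Or.inr ⟨by simp [h1, h2], by tauto⟩)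

/-! ### Signs on complement components -/

namespace IsLocalTournamentOrientation

variable {V : Type u} {G : SimpleGraph V} {r : V → V → Prop}

/-- If the complement is disconnected, then it is bipartite. -/
theorem exists_sign (hr : IsLocalTournamentOrientation G r) :
    ∃ s : V → Bool, ∀ x x' y, x ≠ x' → ¬ G.Adj x x' →
      Gᶜ.connectedComponentMk y ≠ Gᶜ.connectedComponentMk x → s x ≠ s x' := by
  classical
  have : ∀ i : Gᶜ.ConnectedComponent, ∃ z, (∃ y, Gᶜ.connectedComponentMk y ≠ i) →
      Gᶜ.connectedComponentMk z ≠ i := by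
    intro i
    by_cases h : ∃ y, Gᶜ.connectedComponentMk y ≠ i
    · exact ⟨h.choose, fun _ => h.choose_spec⟩
    · exact ⟨i.out, fun h' => (h h').elim⟩
  choose z hz using this
  -- The sign records whether `x` is dominated by a fixed vertex outside its component. If there is
  -- none, the claim is vacuous and the value of `z` is arbitrary.
  refine ⟨fun x => decide (r (z (Gᶜ.connectedComponentMk x)) x), fun x x' y hne hn hy => ?_⟩
  have hxx' := SimpleGraph.component_eq_of_not_adj hn
  have h := hz _ ⟨y, hy⟩
  simp only [← hxx', ne_eq, decide_eq_decide]
  set u := z (Gᶜ.connectedComponentMk x)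
  have h1 : G.Adj u x := SimpleGraph.adj_of_component_ne h
  have h2 : G.Adj u x' := SimpleGraph.adj_of_component_ne (hxx' ▸ h)
  have := hr.iff_of_not_adj h1 h2 hne hn
  have := hr.iff_not h2
  tauto

end IsLocalTournamentOrientation

/-- Along an edge of the complement, both the direction of `A` and the sign change, and the two
changes cancel. -/
theorem switchRel_iff_of_component_eq {V : Type u} {G : SimpleGraph V} {A : V → V → Prop}
    (hA : ∀ u v w, G.Adj u v → G.Adj u w → v ≠ w → ¬ G.Adj v w → (A u v ↔ A w u))
    {s : V → Bool} (hs : ∀ x x' y, x ≠ x' → ¬ G.Adj x x' →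
      Gᶜ.connectedComponentMk y ≠ Gᶜ.connectedComponentMk x → s x ≠ s x')
    {x x' y y' : V} (hx : Gᶜ.connectedComponentMk x = Gᶜ.connectedComponentMk x')
    (hy : Gᶜ.connectedComponentMk y = Gᶜ.connectedComponentMk y')
    (hxy : Gᶜ.connectedComponentMk x ≠ Gᶜ.connectedComponentMk y) :
    switchRel s A x y ↔ switchRel s A x' y' := by
  have key : ∀ x {y y' : V}, Gᶜ.Walk y y' →
      Gᶜ.connectedComponentMk x ≠ Gᶜ.connectedComponentMk y →
      (switchRel s A x y ↔ switchRel s A x y') ∧ (switchRel s A y x ↔ switchRel s A y' x) := by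
    intro x y y' p hxy
    induction p with
    | nil => simp
    | @cons u v w hadj p ih =>
      rw [SimpleGraph.compl_adj] at hadj
      have huv := SimpleGraph.component_eq_of_not_adj hadj.2
      have ih := ih (huv ▸ hxy)
      rw [← ih.1, ← ih.2]
      have h1 := SimpleGraph.adj_of_component_ne hxy
      have h2 := SimpleGraph.adj_of_component_ne (huv ▸ hxy)
      have k1 := hA x u v h1 h2 hadj.1 hadj.2
      have k2 := hA x v u h2 h1 hadj.1.symm fun h => hadj.2 h.symm
      have := hs u v x hadj.1 hadj.2 hxy
      unfold switchRel
      rw [k1, k2]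
      clear hA hs ih
      cases e1 : s x <;> cases e2 : s u <;> cases e3 : s v <;> grind
  obtain ⟨p⟩ := SimpleGraph.ConnectedComponent.exact hx
  obtain ⟨q⟩ := SimpleGraph.ConnectedComponent.exact hy
  exact (key x q hxy).1.trans (key y' p (hy ▸ hxy.symm)).2

/-! ### The combined orientation -/

/-- Combine a switched linear order between the components of the complement, a linear order on
pairs of similar vertices, and the orientation `A`, completed by `r`, of all other edges. -/
def combinedArc {V : Type u} (G : SimpleGraph V) (s : V → Bool)
    (l : Gᶜ.ConnectedComponent → Gᶜ.ConnectedComponent → Prop) (m A r : V → V → Prop)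
    (x y : V) : Prop :=
  G.Adj x y ∧
    ((Gᶜ.connectedComponentMk x ≠ Gᶜ.connectedComponentMk y ∧
        switchRel s (fun x y => l (Gᶜ.connectedComponentMk x) (Gᶜ.connectedComponentMk y)) x y) ∨
      (Gᶜ.connectedComponentMk x = Gᶜ.connectedComponentMk y ∧ G.Similar x y ∧ m x y) ∨
      (Gᶜ.connectedComponentMk x = Gᶜ.connectedComponentMk y ∧ ¬ G.Similar x y ∧
        (A x y ∨ ¬ A y x ∧ r x y)))

section combinedArc

variable {V : Type u} {G : SimpleGraph V} {s : V → Bool}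
  {l : Gᶜ.ConnectedComponent → Gᶜ.ConnectedComponent → Prop} {m A r : V → V → Prop}

/-- Non-adjacent neighbours `v`, `w` of `u` lie in one complement component and neither is similar
to `u`, so both edges fall under the same clause. Between components the opposite signs of `v` and
`w` reverse the arc; inside one, `A` and `r` both respect the forcing. -/
theorem isLocalTournamentOrientation_combinedArc (hr : IsLocalTournamentOrientation G r)
    (hs : ∀ x x' y, x ≠ x' → ¬ G.Adj x x' →
      Gᶜ.connectedComponentMk y ≠ Gᶜ.connectedComponentMk x → s x ≠ s x')
    (hl : ∀ i j, i ≠ j → (l i j ↔ ¬ l j i)) (hm : ∀ x y, x ≠ y → (m x y ↔ ¬ m y x))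
    (hA : ∀ x y, A x y → ¬ A y x)
    (hA' : ∀ u v w, G.Adj u v → G.Adj u w → v ≠ w → ¬ G.Adj v w → (A u v ↔ A w u)) :
    IsLocalTournamentOrientation G (combinedArc G s l m A r) where
  iff_not := by
    intro x y h
    have e1 := hr.iff_not h
    have e2 := hm _ _ h.ne
    have e3 := hA x y
    have e4 := hl (Gᶜ.connectedComponentMk x) (Gᶜ.connectedComponentMk y)
    have e5 : G.Similar x y ↔ G.Similar y x := ⟨Eq.symm, Eq.symm⟩
    unfold combinedArc
    simp only [h, h.symm, true_and, eq_comm (a := Gᶜ.connectedComponentMk y),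
      ne_comm (a := Gᶜ.connectedComponentMk y), ← e5]
    by_cases hc : Gᶜ.connectedComponentMk x = Gᶜ.connectedComponentMk y
    · simp only [hc, ne_eq, not_true_eq_false, false_and, true_and, false_or]
      clear hr hs hl hm hA hA' e4 e5
      grind
    · have e4 := e4 hc
      simp only [ne_eq, hc, not_false_eq_true, false_and, true_and, or_false]
      unfold switchRel
      clear hr hs hl hm hA hA' e5
      cases s x <;> cases s y <;> grind
  iff_of_not_adj := by
    intro u v w huv huw hvw hn
    have hc := SimpleGraph.component_eq_of_not_adj hn
    have s1 : ¬ G.Similar u v := fun h => hn ((h.adj_iff huw.ne' hvw.symm).1 huw)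
    have s2 : ¬ G.Similar w u := fun h => hn ((h.adj_iff hvw huv.ne').2 huv).symm
    have e1 := hr.iff_of_not_adj huv huw hvw hn
    have e2 := hA' u v w huv huw hvw hn
    have e3 := hA' u w v huw huv hvw.symm fun h => hn h.symm
    unfold combinedArc
    simp only [huv, huw.symm, true_and, ← hc, s1, s2, false_and, and_false, false_or,
      not_false_eq_true, eq_comm (a := Gᶜ.connectedComponentMk v),
      ne_comm (a := Gᶜ.connectedComponentMk v)]
    rw [e1, e2, e3]
    by_cases h : Gᶜ.connectedComponentMk u = Gᶜ.connectedComponentMk v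
    · simp [h]
    · have := hs v w u hvw hn h
      simp only [ne_eq, h, not_false_eq_true, true_and, false_and, or_false]
      unfold switchRel
      clear hr hl hm hA hA' hs e1 e2 e3
      cases e1 : s u <;> cases e2 : s v <;> cases e3 : s w <;> grind

theorem not_isObstruction_combinedArc (hG : G.Connected)
    (hD : IsLocalTournamentOrientation G (combinedArc G s l m A r))
    (hltrans : ∀ i j k, l i j → l j k → l i k) (hl : ∀ i j, i ≠ j → (l i j ↔ ¬ l j i))
    (hmtrans : ∀ x y z, m x y → m y z → m x z) (hm : ∀ x y, x ≠ y → (m x y ↔ ¬ m y x))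
    (a b c d : V) : ¬ IsObstruction G (combinedArc G s l m A r) a b c d := by
  intro h
  -- Similar vertices that all miss `w` share its complement component, so their arcs follow the
  -- linear order `m`.
  have hcell : ∀ x y z w, w ≠ x → ¬ G.Adj w x → G.Similar x y → G.Similar x z →
      combinedArc G s l m A r x y → combinedArc G s l m A r y z →
      ¬ combinedArc G s l m A r z x := by
    intro x y z w hwx hn sxy sxz hxy hyz hzx
    have hcomp : ∀ {v}, G.Similar x v →
        Gᶜ.connectedComponentMk v = Gᶜ.connectedComponentMk w := by
      intro v hv
      refine SimpleGraph.component_eq_of_not_adj fun h => ?_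
      have hwv : w ≠ v := h.ne'
      exact hn ((hv.adj_iff hwx hwv).2 h).symm
    have hc : Gᶜ.connectedComponentMk x = Gᶜ.connectedComponentMk w := hcomp rfl
    have key : ∀ {u v}, G.Similar x u → G.Similar x v → combinedArc G s l m A r u v → m u v := by
      rintro u v hu hv ⟨-, h | h | h⟩
      · exact (h.1 ((hcomp hu).trans (hcomp hv).symm)).elim
      · exact h.2.2
      · exact (h.2.1 (hu.symm.trans hv)).elim
    have m1 := key rfl sxy hxy
    have m2 := key sxy sxz hyz
    have m3 := key sxz rfl hzx
    exact (hm x z hzx.1.ne').1 (hmtrans _ _ _ m1 m2) m3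
  have hab := h.component_ne hD hG hcell
  have hac := (h.swap₂₃ hD).component_ne hD hG hcell
  have had := ((h.swap₃₄ hD).swap₂₃ hD).component_ne hD hG hcell
  have hbc := ((h.swap₁₂ hD).swap₂₃ hD).component_ne hD hG hcell
  have hbd := (((h.swap₁₂ hD).swap₃₄ hD).swap₂₃ hD).component_ne hD hG hcell
  have hcd := ((((h.swap₁₃ hD).swap₃₄ hD).swap₂₃ hD)).component_ne hD hG hcell
  have key : ∀ {x y}, Gᶜ.connectedComponentMk x ≠ Gᶜ.connectedComponentMk y →
      (combinedArc G s l m A r x y ↔ switchRel s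
        (fun x y => l (Gᶜ.connectedComponentMk x) (Gᶜ.connectedComponentMk y)) x y) := by
    intro x y hxy
    simp [combinedArc, SimpleGraph.adj_of_component_ne hxy, hxy]
  refine not_isObstruction_switchRel hltrans hl hab hac had hbc hbd hcd
    ⟨h.ab, h.ac, h.ad, h.bc, h.bd, h.cd, ?_, ?_⟩ (s := s) (G := G)
  · rw [← key hab, ← key hcd, ← key hac, ← key hbd.symm]
    exact h.left
  · rw [← key had, ← key hbc, ← key hac, ← key hbd.symm]
    exact h.right

end combinedArc

/-! ### Cells and universal vertices -/

namespace SimpleGraph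

variable {V : Type u} {G : SimpleGraph V}

theorem isCell_setOf_similar (x : V) : G.IsCell {v | G.Similar x v} := by
  refine ⟨fun u hu v hv => hu.symm.trans hv, fun S hS hle v hv => hS x (hle rfl) v hv⟩

theorem IsCell.eq_setOf_similar {B : Set V} (hB : G.IsCell B) {x : V} (hx : x ∈ B) :
    B = {v | G.Similar x v} :=
  hB.eq_of_subset (isCell_setOf_similar x).prop fun v hv => hB.prop x hx v hv

theorem mem_universalVertices_iff {x : V} :
    x ∈ G.universalVertices ↔ insert x (G.neighborSet x) = Set.univ := by
  rw [Set.eq_univ_iff_forall]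
  simp only [universalVertices, Set.mem_ofPred_eq, Set.mem_insert_iff, mem_neighborSet]
  exact forall_congr' fun w => by tauto

theorem setOf_similar_eq_universalVertices_iff {x : V} :
    {v | G.Similar x v} = G.universalVertices ↔ x ∈ G.universalVertices := by
  refine ⟨fun h => h ▸ (rfl : G.Similar x x), fun h => ?_⟩
  ext v
  rw [mem_universalVertices_iff] at *
  simp only [Set.mem_ofPred_eq, Similar, h]
  exact eq_comm

theorem eq_of_mem_universalVertices {x y : V} (hx : x ∈ G.universalVertices)
    (h : Gᶜ.connectedComponentMk x = Gᶜ.connectedComponentMk y) : x = y := by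
  obtain ⟨p⟩ := ConnectedComponent.exact h
  cases p with
  | nil => rfl
  | cons hadj _ =>
    rw [compl_adj] at hadj
    exact (hadj.2 (hx _ hadj.1.symm)).elim

end SimpleGraph

namespace OrientedGraph

variable {V : Type u} {D : OrientedGraph V}

/-- A non-universal cell lies in the in-neighbourhood or in the out-neighbourhood of a vertex. -/
theorem IsLocalTournament.exists_subset_nbhd (hD : D.IsLocalTournament)
    (hG : D.underlyingGraph.Connected) {B : Set V} (hB : D.underlyingGraph.IsNonUniversalCell B)
    {x : V} (hx : x ∈ B) : ∃ w, B ⊆ D.inNbhd w ∨ B ⊆ D.outNbhd w := by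
  set G := D.underlyingGraph with hGdef
  have hr := hD.isLocalTournamentOrientation
  have hBx := hB.1.eq_setOf_similar hx
  have hxu : x ∉ G.universalVertices := fun h =>
    hB.2 (hBx.trans (SimpleGraph.setOf_similar_eq_universalVertices_iff.2 h))
  simp only [SimpleGraph.universalVertices, Set.mem_ofPred_eq, not_forall] at hxu
  obtain ⟨y, hyx, hy⟩ := hxu
  -- An edge leaves the closed neighbourhood of `x`: `w` is adjacent to the whole cell and `z` to
  -- none of it, so the arc between `w` and `z` forces all arcs between `w` and the cell.
  obtain ⟨⟨⟨w, z⟩, hwz⟩, -, hw, hz⟩ := (hG.preconnected x y).some.exists_boundary_dart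
    (insert x (G.neighborSet x)) (by simp) (by simp [hyx, hy])
  simp only at hw hz hwz
  have key : ∀ b ∈ B, G.Adj w b ∧ (D.Arc w b ↔ D.Arc z w) := by
    intro b hb
    rw [hBx] at hb
    have hs : insert x (G.neighborSet x) = insert b (G.neighborSet b) := hb
    rw [hs] at hw hz
    simp only [Set.mem_insert_iff, SimpleGraph.mem_neighborSet, not_or] at hw hz
    have hwb : G.Adj w b := by
      rcases hw with rfl | hw
      · exact (hz.2 hwz).elim
      · exact hw.symm
    exact ⟨hwb, hr.iff_of_not_adj hwb hwz (Ne.symm hz.1) hz.2⟩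
  refine ⟨w, ?_⟩
  by_cases h : D.Arc z w
  · exact Or.inr fun b hb => (key b hb).2.2 h
  · exact Or.inl fun b hb => (key b hb).1.resolve_left fun h' => h ((key b hb).2.1 h')

theorem HasDirectedCycleIn.mono {D' : OrientedGraph V} (hD : ∀ x y, D.Arc x y → D'.Arc x y)
    {S T : Set V} (hST : S ⊆ T) (h : D.HasDirectedCycleIn S) : D'.HasDirectedCycleIn T := by
  obtain ⟨n, c, hc, hS, harc⟩ := h
  exact ⟨n, c, hc, fun i => hST (hS i), fun i => hD _ _ (harc i)⟩

theorem IsLocallyTransitive.not_hasDirectedCycleIn (hD : D.IsLocallyTransitive) (v : V) :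
    ¬ D.HasDirectedCycleIn (D.inNbhd v) ∧ ¬ D.HasDirectedCycleIn (D.outNbhd v) :=
  ⟨not_hasDirectedCycleIn_of_trans (hD v).1.2, not_hasDirectedCycleIn_of_trans (hD v).2.2⟩

end OrientedGraph

/-! ### The partial order on complement components -/

/-- If no directed triangle of `A` lies in a neighbourhood, then no switching of `A` has a directed
triangle dominated by a vertex. -/
theorem not_switchRel_of_dominated_triangle {α : Type*} {A : α → α → Prop} {s : α → Bool}
    (hin : ∀ v x y z, A x v → A y v → A z v → A x y → A y z → ¬ A z x)
    (hout : ∀ v x y z, A v x → A v y → A v z → A x y → A y z → ¬ A z x) {v x y z : α}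
    (hx : switchRel s A v x) (hy : switchRel s A v y) (hz : switchRel s A v z)
    (hxy : switchRel s A x y) (hyz : switchRel s A y z) : ¬ switchRel s A z x := by
  intro hzx
  -- Every switching of a dominated directed triangle is again a directed triangle with a source or
  -- a sink; the instances cover the positions that occur.
  have i1 := hin v x z y
  have i2 := hin x v y z
  have i3 := hin y v z x
  have i4 := hin z v x y
  have i5 := hin x y v z
  have i6 := hin y z v x
  have i7 := hin z x v y
  have o1 := hout v x y z
  have o2 := hout x y v z
  have o3 := hout y z v x
  have o4 := hout z x v y
  have o5 := hout x v y z
  have o6 := hout y v z x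
  have o7 := hout z v x y
  have o8 := hout v x z y
  have i8 := hin v x y z
  unfold switchRel at *
  clear hin hout
  cases e1 : s v <;> cases e2 : s x <;> cases e3 : s y <;> cases e4 : s z <;>
    simp only [e1, e2, e3, e4, ne_eq, not_true_eq_false, not_false_eq_true, true_and, false_and,
      or_false, false_or, reduceCtorEq] at hx hy hz hxy hyz hzx <;> simp_all

namespace PartiallyOrientedGraph

variable {V : Type u} {P : PartiallyOrientedGraph V}

theorem adj_of_arc {x y : V} (h : P.arcs.Arc x y) : P.underlyingGraph.Adj x y :=
  Or.inr (Or.inl h)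

/-- In a friendly partial orientation without directed cycles in neighbourhoods, the arcs between
distinct components of the complement come from a strict partial order on the components by
switching. -/
theorem Friendly.exists_switched_order (hP : P.Friendly) {r : V → V → Prop}
    (hr : IsLocalTournamentOrientation P.underlyingGraph r)
    (hcycle : ∀ v : V, ¬ P.arcs.HasDirectedCycleIn (P.arcs.inNbhd v) ∧
      ¬ P.arcs.HasDirectedCycleIn (P.arcs.outNbhd v)) :
    ∃ (s : V → Bool) (S : P.underlyingGraphᶜ.ConnectedComponent →
      P.underlyingGraphᶜ.ConnectedComponent → Prop),
      (∀ x x' y, x ≠ x' → ¬ P.underlyingGraph.Adj x x' →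
        P.underlyingGraphᶜ.connectedComponentMk y ≠ P.underlyingGraphᶜ.connectedComponentMk x →
          s x ≠ s x') ∧
      (∀ i, ¬ S i i) ∧ (∀ i j k, S i j → S j k → S i k) ∧
      ∀ x y, P.underlyingGraphᶜ.connectedComponentMk x ≠
          P.underlyingGraphᶜ.connectedComponentMk y → P.arcs.Arc x y →
        switchRel s (fun x y => S (P.underlyingGraphᶜ.connectedComponentMk x)
          (P.underlyingGraphᶜ.connectedComponentMk y)) x y := by
  set G := P.underlyingGraph with hG
  set c := Gᶜ.connectedComponentMk with hc
  set A := P.arcs.Arc with hAdef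
  obtain ⟨σ, hσ⟩ := hr.exists_sign
  have hA := P.arcs.asymm
  have hA' : ∀ u v w, G.Adj u v → G.Adj u w → v ≠ w → ¬ G.Adj v w → (A u v ↔ A w u) :=
    fun u v w => hP.1.arc_iff hr
  have hin : ∀ v x y z, A x v → A y v → A z v → A x y → A y z → ¬ A z x :=
    fun v x y z h1 h2 h3 h4 h5 h6 =>
      (hcycle v).1 (OrientedGraph.hasDirectedCycleIn_of_triangle h1 h2 h3 h4 h5 h6)
  have hout : ∀ v x y z, A v x → A v y → A v z → A x y → A y z → ¬ A z x :=
    fun v x y z h1 h2 h3 h4 h5 h6 =>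
      (hcycle v).2 (OrientedGraph.hasDirectedCycleIn_of_triangle h1 h2 h3 h4 h5 h6)
  have hrep : ∀ i, ∃ x, c x = i := fun i => i.exists_rep
  choose ρ hρ using hrep
  let T : Gᶜ.ConnectedComponent → Gᶜ.ConnectedComponent → Prop :=
    fun i j => i ≠ j ∧ switchRel σ A (ρ i) (ρ j)
  have hT : ∀ x y, c x ≠ c y → (T (c x) (c y) ↔ switchRel σ A x y) := by
    intro x y hxy
    simp only [T, ne_eq, hxy, not_false_eq_true, true_and]
    exact switchRel_iff_of_component_eq hA' hσ (hρ _) (hρ _) (by rwa [← hc, hρ, hρ])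
  have hTasymm : ∀ i j, T i j → ¬ T j i := fun i j h h' =>
    switchRel_asymm (hA _ _) h.2 h'.2
  have hTor : ∀ i j, T i j ∨ T j i ↔ i ≠ j ∧ P.IsOriented (ρ i) (ρ j) := by
    intro i j
    change _ ↔ i ≠ j ∧ (A (ρ i) (ρ j) ∨ A (ρ j) (ρ i))
    rw [← switchRel_or_switchRel (s := σ)]
    simp only [T, ne_comm (a := j)]
    tauto
  have hTtrans : ∀ i j k, i ≠ k → T i j ∨ T j i → T j k ∨ T k j → T i k ∨ T k i := by
    intro i j k hik hij hjk
    rw [hTor] at *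
    refine ⟨hik, SimpleGraph.Adj.symm ?_⟩
    refine hP.isOriented_of_component_ne ?_ ?_ ?_ hij.2 hjk.2
    all_goals
      rw [← hG, ← hc, hρ, hρ]
      tauto
  obtain ⟨t, ht⟩ := exists_switchRel_dominating T hTtrans
  -- Switching by `σ` makes arcs depend on components only, and switching by `t` gives dominating
  -- components; the exclusive or performs both at once and stays constant relative to `σ` on each
  -- component.
  let s : V → Bool := fun x => σ x ^^ t (c x)
  have hsA : ∀ x y, c x ≠ c y → (switchRel s A x y ↔ switchRel t T (c x) (c y)) := by
    intro x y hxy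
    have e1 := hT x y hxy
    have e2 := hT y x hxy.symm
    unfold switchRel at *
    simp only [s]
    rw [e1, e2]
    cases σ x <;> cases σ y <;> cases t (c x) <;> cases t (c y) <;> simp
  have hne : ∀ {i j}, switchRel t T i j → i ≠ j := by
    rintro i j (h | h)
    exacts [h.2.1, h.2.1.symm]
  have hasymm : ∀ {i j}, switchRel t T i j → ¬ switchRel t T j i := fun h =>
    switchRel_asymm (hTasymm _ _) h
  have hor : ∀ {i j}, switchRel t T i j → T i j ∨ T j i := fun h =>
    switchRel_or_switchRel.1 (Or.inl h)
  have hρS : ∀ {i j}, switchRel t T i j → switchRel s A (ρ i) (ρ j) := by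
    intro i j h
    have := hsA (ρ i) (ρ j)
    rw [hρ, hρ] at this
    exact (this (hne h)).2 h
  refine ⟨s, switchRel t T, ?_, fun i h => hne h rfl, ?_, ?_⟩
  · intro x x' y hxx' hn hy
    have h1 := hσ x x' y hxx' hn hy
    have h2 : c x = c x' := SimpleGraph.component_eq_of_not_adj hn
    simpa [s, h2] using h1
  · intro i j k hij hjk
    have hik : i ≠ k := by
      rintro rfl
      exact hasymm hij hjk
    have hik' := hTtrans _ _ _ hik (hor hij) (hor hjk)
    refine (switchRel_or_switchRel.2 hik').resolve_right fun hki => ?_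
    -- The dominating component `q` of the class cannot lie on the directed triangle `i`, `j`, `k`,
    -- so it dominates that triangle.
    obtain ⟨q, hq⟩ := ht i
    have di := hq i (Or.inl rfl)
    have dj := hq j (Or.inr (hor hij))
    have dk := hq k (Or.inr hik')
    have hi : i ≠ q := by
      rintro rfl
      rcases dk with h | h
      exacts [hik h.symm, hasymm hki h]
    have hj : j ≠ q := by
      rintro rfl
      exact hasymm hij (di.resolve_left hi)
    have hk : k ≠ q := by
      rintro rfl
      exact hasymm hjk (dj.resolve_left hj)
    exact not_switchRel_of_dominated_triangle hin hout (hρS (di.resolve_left hi))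
      (hρS (dj.resolve_left hj)) (hρS (dk.resolve_left hk)) (hρS hij) (hρS hjk) (hρS hki)
  · intro x y hxy h
    by_cases hs : s x = s y
    · exact Or.inl ⟨hs, (hsA x y hxy).1 (Or.inl ⟨hs, h⟩)⟩
    · exact Or.inr ⟨hs, (hsA y x hxy.symm).1 (Or.inr ⟨Ne.symm hs, h⟩)⟩

/-! ### Ordering the cells and completing the orientation -/

/-- Edges between similar vertices form their own components of the auxiliary graph, so the absence
of bad triples forces the third edge to be oriented; the other direction would close a directed
triangle in a non-universal cell. -/
theorem Friendly.arc_trans_of_similar (hP : P.Friendly)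
    (hcell : ∀ B : Set V, P.underlyingGraph.IsNonUniversalCell B →
      ¬ P.arcs.HasDirectedCycleIn B) {x y z : V}
    (hx : x ∉ P.underlyingGraph.universalVertices)
    (sxy : P.underlyingGraph.Similar x y) (syz : P.underlyingGraph.Similar y z)
    (hxy : P.arcs.Arc x y) (hyz : P.arcs.Arc y z) : P.arcs.Arc x z := by
  have hzx : z ≠ x := by
    rintro rfl
    exact P.arcs.asymm _ _ hxy hyz
  have h := hP.isOriented_of_similar sxy syz (adj_of_arc hxy).ne (adj_of_arc hyz).ne hzx
    (Or.inl hxy) (Or.inl hyz)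
  refine h.resolve_left fun h' => hcell {v | P.underlyingGraph.Similar x v}
    ⟨SimpleGraph.isCell_setOf_similar x,
      fun h => hx (SimpleGraph.setOf_similar_eq_universalVertices_iff.1 h)⟩
    (OrientedGraph.hasDirectedCycleIn_of_triangle rfl sxy (sxy.trans syz) hxy hyz h')

theorem Friendly.exists_completion (hP : P.Friendly) (hconn : P.underlyingGraph.Connected)
    (horient : P.underlyingGraph.LocalTournamentOrientable)
    (hcell : ∀ B : Set V, P.underlyingGraph.IsNonUniversalCell B →
      ¬ P.arcs.HasDirectedCycleIn B)
    (hcycle : ∀ v : V, ¬ P.arcs.HasDirectedCycleIn (P.arcs.inNbhd v) ∧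
      ¬ P.arcs.HasDirectedCycleIn (P.arcs.outNbhd v)) :
    ∃ D : OrientedGraph V, P.CompletesTo D ∧ D.IsLocalTournament ∧ D.IsLocallyTransitive := by
  obtain ⟨D₀, hD₀, hlt⟩ := horient
  have hr := hlt.isLocalTournamentOrientation
  rw [hD₀] at hr
  obtain ⟨s, S, hs, hSirr, hStrans, hSA⟩ := hP.exists_switched_order hr hcycle
  obtain ⟨l, hSl, hltrans, hl⟩ := exists_strict_linear_extension S hSirr hStrans
  -- Universal vertices are left out because their cell may contain directed cycles. Each is a
  -- complement component by itself, so its arcs are governed by `l`.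
  obtain ⟨m, hRm, hmtrans, hm⟩ := exists_strict_linear_extension
    (fun x y => x ∉ P.underlyingGraph.universalVertices ∧ P.underlyingGraph.Similar x y ∧
      P.arcs.Arc x y)
    (fun x h => P.arcs.asymm _ _ h.2.2 h.2.2)
    (fun x y z h h' => ⟨h.1, h.2.1.trans h'.2.1,
      hP.arc_trans_of_similar hcell h.1 h.2.1 h'.2.1 h.2.2 h'.2.2⟩)
  have hD := isLocalTournamentOrientation_combinedArc (m := m) hr hs hl hm P.arcs.asymm
    fun u v w => hP.1.arc_iff hr
  have hobs := not_isObstruction_combinedArc hconn hD hltrans hl hmtrans hm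
  let D : OrientedGraph V :=
    { Arc := combinedArc P.underlyingGraph s l m P.arcs.Arc D₀.Arc
      asymm := fun x y h => (hD.iff_not h.1).1 h }
  have hDG : D.underlyingGraph = P.underlyingGraph := by
    ext x y
    refine ⟨fun h => h.elim (fun h => h.1) fun h => h.1.symm, fun h => ?_⟩
    by_contra hn
    exact hn (Or.inl ((hD.iff_not h).2 fun h' => hn (Or.inr h')))
  have hDlt : D.IsLocalTournament :=
    OrientedGraph.isLocalTournament_of_orientation (by rw [hDG]; exact hD)
  refine ⟨D, ⟨hDG, fun x y h => ⟨adj_of_arc h, ?_⟩⟩, hDlt,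
    OrientedGraph.isLocallyTransitive_of_forall_not_isObstruction hDlt
      (by rw [hDG]; exact hobs)⟩
  by_cases hxy : P.underlyingGraphᶜ.connectedComponentMk x =
      P.underlyingGraphᶜ.connectedComponentMk y
  · by_cases hsim : P.underlyingGraph.Similar x y
    · refine Or.inr (Or.inl ⟨hxy, hsim, hRm _ _ ⟨fun hu => ?_, hsim, h⟩⟩)
      exact (adj_of_arc h).ne (SimpleGraph.eq_of_mem_universalVertices hu hxy)
    · exact Or.inr (Or.inr ⟨hxy, hsim, Or.inl h⟩)
  · refine Or.inl ⟨hxy, ?_⟩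
    exact (hSA x y hxy h).imp (And.imp_right (hSl _ _)) (And.imp_right (hSl _ _))

end PartiallyOrientedGraph

theorem theorem4p12 {V : Type*} [Finite V] (G : SimpleGraph V) (hconn : G.Connected)
    (horient : G.LocalTournamentOrientable) (P : PartiallyOrientedGraph V)
    (hP : P.IsPartialOrientationOf G) (hfriendly : P.Friendly) :
    (∃ D : OrientedGraph V, P.CompletesTo D ∧ D.IsLocalTournament ∧ D.IsLocallyTransitive) ↔
      (∀ B : Set V, G.IsNonUniversalCell B → ¬ P.arcs.HasDirectedCycleIn B) ∧
        ∀ v : V, ¬ P.arcs.HasDirectedCycleIn (P.arcs.inNbhd v) ∧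
          ¬ P.arcs.HasDirectedCycleIn (P.arcs.outNbhd v) := by
  have hPG : P.underlyingGraph = G := hP
  subst hPG
  refine ⟨?_, fun h => hfriendly.exists_completion hconn horient h.1 h.2⟩
  rintro ⟨D, ⟨hDG, hPD⟩, hlt, htr⟩
  refine ⟨fun B hB h => ?_, fun v => ⟨fun h => ?_, fun h => ?_⟩⟩
  · rw [← hDG] at hB hconn
    obtain ⟨w, hw | hw⟩ := hlt.exists_subset_nbhd hconn hB (h.choose_spec.choose_spec.2.1 0)
    · exact (htr.not_hasDirectedCycleIn w).1 (h.mono hPD hw)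
    · exact (htr.not_hasDirectedCycleIn w).2 (h.mono hPD hw)
  · exact (htr.not_hasDirectedCycleIn v).1 (h.mono hPD fun x hx => hPD _ _ hx)
  · exact (htr.not_hasDirectedCycleIn v).2 (h.mono hPD fun x hx => hPD _ _ hx)
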